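/- Let $S^2=\{x\in\mathbb{R}^3:|x|=1\}$ be the unit sphere with its standard round metric, and let $\Delta_{S^2}$ be its Laplace--Beltrami operator (with the sign convention that its eigenvalues are $\le 0$). There exists $\delta_0>0$ such that every $C^2$ function $u:S^2\to\mathbb{R}$ which satisfies $$\Delta_{S^2}u=6-6e^{u}\quad\text{on } S^2$$ and $\sup_{S^2}|u|<\delta_0$ vanishes identically on $S^2$. -/

import Mathlib

open scoped Manifold

/-- Euclidean three-space. -/
abbrev E3 : Type := EuclideanSpace ℝ (Fin 3)

/-- The round unit sphere `S² ⊆ ℝ³`. -/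
abbrev S2 : Type := Metric.sphere (0 : E3) 1

instance factFinrankE3 : Fact (Module.finrank ℝ E3 = 2 + 1) := ⟨by simp⟩

theorem normalize_mem_sphere {y : E3} (hy : y ≠ 0) :
    ‖y‖⁻¹ • y ∈ Metric.sphere (0 : E3) 1 := by
  rw [mem_sphere_zero_iff_norm, norm_smul, norm_inv, norm_norm,
    inv_mul_cancel₀ (norm_ne_zero_iff.mpr hy)]

open Classical in
/-- The extension of `u : S² → ℝ` to `ℝ³ \ {0}` that is constant along rays, `y ↦ u (y / |y|)`
(with the irrelevant value `0` at the origin). -/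
noncomputable def radialExtension (u : S2 → ℝ) (y : E3) : ℝ :=
  if hy : y = 0 then 0 else u ⟨‖y‖⁻¹ • y, normalize_mem_sphere hy⟩

/-- The Laplace–Beltrami operator of the round unit sphere, on `C²` functions: the Euclidean
Laplacian of the extension that is constant along rays, evaluated on the sphere. In polar
coordinates `Δ_{ℝ³} = ∂_r² + (2/r) ∂_r + r⁻² Δ_{S²}`, and the radial terms vanish on such an
extension. -/
noncomputable def sphereLaplacian (u : S2 → ℝ) (x : S2) : ℝ :=
  Laplacian.laplacian (radialExtension u) (x : E3)

/-- `u` is a (classical, `C²`) solution of the mean-field equation `Δ_{S²} u = 6 - 6 eᵘ`. -/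
def IsMeanFieldSolution (u : S2 → ℝ) : Prop :=
  ContMDiff (𝓡 2) 𝓘(ℝ, ℝ) 2 u ∧ ∀ x : S2, sphereLaplacian u x = 6 - 6 * Real.exp (u x)

/-!
The linearisation of the equation at `0` is `Δu + 6u = 0`, whose solutions are the spherical
harmonics of degree two, that is, the restrictions `φ_A(x) = ⟪Ax, x⟫` of the quadratic forms of
symmetric traceless matrices `A`. So the linearised operator is degenerate, and rigidity comes from
the second-order term.

Write `N = eᵘ - 1 - u`, so that `Δu + 6u = -6N`, and let `φ = φ_A` be the `L²`-projection of `u` to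
the harmonics of degree two. The other eigenvalues of `Δ` are at distance at least `4` from `-6`, so
`‖u - φ‖ ≤ ‖6N‖ / 4`, which is `O(δ ‖u‖)` if `|u| ≤ δ` (`exists_harmonic_quad_close`). Testing the
equation with a harmonic `ψ` of degree two gives `∫ N ψ = 0`
(`IsMeanFieldSolution.integral_remainder_mul_eq_zero`). As `N` is `u² / 2` up to third order, this
says that `∫ φ² ψ` is at most of order `δ ‖φ‖² sup |ψ|`. On the other hand, with `B` the traceless
part of `A²` and `ψ = φ_B`, the integral `∫ φ² ψ` is a positive multiple of `tr (A² B)`, and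
`tr (A² B) = (tr A²)² / 6` (`Poly3.integral_diag_sq_mul`). For small `δ` this forces `A = 0`, and
then `u = 0` (`IsMeanFieldSolution.eq_zero_of_abs_le`).

The analysis on the sphere rests on the three rotation fields. On functions constant along rays the
Euclidean Laplacian at a unit vector is the sum of their squares (`laplacian_eq_sum_rotDeriv`), and
each of them is skew for the `L²` pairing because the surface measure is rotation invariant
(`integral_rotDeriv`). Acting on polynomials, the same sum of squares decomposes every polynomial
into eigenvectors with eigenvalues `-j (j + 1)` (`Poly3.exists_sum_harmonic`). Since polynomials are
dense in `L²` of the sphere, the spectral gap estimate follows by duality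
(`norm_le_of_inner_eq_mul_inner`), without spectral theory of unbounded operators. The sixth moments
needed for the cubic form also come from the vanishing of integrals of rotation derivatives.
-/

open MeasureTheory

/-! ### Rotation fields and the invariant measure on the sphere -/

/-- The generator of the rotations of `ℝ³` about the `i`-th coordinate axis, a skew-symmetric map;
indices are taken modulo `3`. -/
noncomputable def rotGen (i : Fin 3) : E3 →L[ℝ] E3 :=
  (EuclideanSpace.proj (i + 1) : E3 →L[ℝ] ℝ).smulRight (EuclideanSpace.single (i + 2) (1 : ℝ)) -
  (EuclideanSpace.proj (i + 2) : E3 →L[ℝ] ℝ).smulRight (EuclideanSpace.single (i + 1) (1 : ℝ))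

theorem rotGen_apply (i : Fin 3) (y : E3) :
    rotGen i y = y (i + 1) • EuclideanSpace.single (i + 2) (1 : ℝ) -
      y (i + 2) • EuclideanSpace.single (i + 1) (1 : ℝ) := rfl

theorem rotGen_cube (i : Fin 3) (y : E3) : rotGen i (rotGen i (rotGen i y)) = -rotGen i y := by
  ext j
  fin_cases i <;> fin_cases j <;> simp [rotGen_apply]

theorem sum_rotGen_rotGen (y : E3) : ∑ i, rotGen i (rotGen i y) = (-2 : ℝ) • y := by
  ext j
  fin_cases j <;> simp [rotGen_apply, Fin.sum_univ_three] <;> ring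

/-- Rotation by the angle `t` about the `i`-th axis, by Rodrigues' formula. -/
noncomputable def rot (i : Fin 3) (t : ℝ) : E3 →L[ℝ] E3 :=
  ContinuousLinearMap.id ℝ E3 + Real.sin t • rotGen i +
    (1 - Real.cos t) • (rotGen i).comp (rotGen i)

theorem rot_apply (i : Fin 3) (t : ℝ) (y : E3) :
    rot i t y = y + Real.sin t • rotGen i y + (1 - Real.cos t) • rotGen i (rotGen i y) := rfl

theorem norm_rot (i : Fin 3) (t : ℝ) (y : E3) : ‖rot i t y‖ = ‖y‖ := by
  rw [← sq_eq_sq₀ (norm_nonneg _) (norm_nonneg _), EuclideanSpace.real_norm_sq_eq,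
    EuclideanSpace.real_norm_sq_eq]
  have h := Real.sin_sq_add_cos_sq t
  fin_cases i <;> simp [rot_apply, rotGen_apply, Fin.sum_univ_three]
  · linear_combination (y 1 ^ 2 + y 2 ^ 2) * h
  · linear_combination (y 0 ^ 2 + y 2 ^ 2) * h
  · linear_combination (y 0 ^ 2 + y 1 ^ 2) * h

theorem hasDerivAt_rot (i : Fin 3) (y : E3) (t : ℝ) :
    HasDerivAt (fun s => rot i s y) (rotGen i (rot i t y)) t := by
  have h := (((Real.hasDerivAt_sin t).smul_const (rotGen i y)).const_add y).add
    (((Real.hasDerivAt_cos t).const_sub 1).smul_const (rotGen i (rotGen i y)))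
  convert! h using 1
  rw [rot_apply, map_add, map_add, map_smul, map_smul, rotGen_cube]
  module

/-- The rotation-invariant surface measure on the unit sphere. -/
noncomputable abbrev sphMeas : Measure S2 := (volume : Measure E3).toSphere

/-- The action of a linear isometry of `ℝ³` on the unit sphere. -/
noncomputable def sphMap (T : E3 ≃ₗᵢ[ℝ] E3) (x : S2) : S2 := ⟨T x, by simp⟩

theorem continuous_sphMap (T : E3 ≃ₗᵢ[ℝ] E3) : Continuous (sphMap T) :=
  (T.continuous.comp continuous_subtype_val).subtype_mk _

open scoped Pointwise in
theorem measurePreserving_sphMap (T : E3 ≃ₗᵢ[ℝ] E3) :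
    MeasurePreserving (sphMap T) sphMeas sphMeas := by
  refine ⟨(continuous_sphMap T).measurable, ?_⟩
  ext s hs
  rw [Measure.map_apply (continuous_sphMap T).measurable hs, Measure.toSphere_apply' _ hs,
    Measure.toSphere_apply' _ ((continuous_sphMap T).measurable hs)]
  congr 1
  rw [← (T.measurePreserving).measure_preimage_equiv (f := T.toMeasurableEquiv)
    (Set.Ioo (0 : ℝ) 1 • (Subtype.val '' s))]
  congr 1
  ext y
  simp only [Set.mem_smul, Set.mem_image, Set.mem_preimage]
  constructor
  · rintro ⟨r, hr, _, ⟨x, hx, rfl⟩, rfl⟩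
    exact ⟨r, hr, _, ⟨sphMap T x, hx, rfl⟩, (map_smul T r (x : E3)).symm⟩
  · rintro ⟨r, hr, _, ⟨x, hx, rfl⟩, h⟩
    have hx' : sphMap T (sphMap T.symm x) = x := by ext; simp [sphMap]
    refine ⟨r, hr, _, ⟨sphMap T.symm x, ?_, rfl⟩, ?_⟩
    · simpa [hx'] using hx
    · apply T.injective
      refine Eq.trans ?_ h
      simp [sphMap]

theorem integral_sphMap (T : E3 ≃ₗᵢ[ℝ] E3) (f : S2 → ℝ) (hf : Continuous f) :
    ∫ x, f (sphMap T x) ∂sphMeas = ∫ x, f x ∂sphMeas := by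
  conv_rhs => rw [← (measurePreserving_sphMap T).map_eq]
  rw [integral_map (continuous_sphMap T).aemeasurable]
  exact hf.aestronglyMeasurable

theorem integrable_of_continuous {f : S2 → ℝ} (hf : Continuous f) : Integrable f sphMeas :=
  hf.integrable_of_hasCompactSupport (HasCompactSupport.of_compactSpace f)

theorem integrable_mul_of_continuous {f g : S2 → ℝ} (hf : Continuous f) (hg : Continuous g) :
    Integrable (fun x => f x * g x) sphMeas :=
  integrable_of_continuous (hf.mul hg)

/-- Derivative of `F` along the `i`-th rotation field. -/
noncomputable def rotDeriv (i : Fin 3) (F : E3 → ℝ) (y : E3) : ℝ := fderiv ℝ F y (rotGen i y)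

theorem sphere_ne_zero (x : S2) : (x : E3) ∈ ({0}ᶜ : Set E3) := ne_zero_of_mem_unit_sphere x

theorem ContDiffOn.contDiffAt_compl_zero {n : ℕ∞} {F : E3 → ℝ} (hF : ContDiffOn ℝ n F {0}ᶜ)
    {y : E3} (hy : y ≠ 0) : ContDiffAt ℝ n F y :=
  hF.contDiffAt (isOpen_compl_singleton.mem_nhds hy)

theorem contDiffOn_rotDeriv {m n : ℕ∞} {F : E3 → ℝ} (hF : ContDiffOn ℝ n F {0}ᶜ) (hmn : m + 1 ≤ n)
    (i : Fin 3) : ContDiffOn ℝ m (rotDeriv i F) {0}ᶜ :=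
  (hF.fderiv_of_isOpen isOpen_compl_singleton (by exact_mod_cast hmn)).clm_apply
    (rotGen i).contDiff.contDiffOn

theorem ContDiffOn.continuous_restrict_sphere {n : ℕ∞} {F : E3 → ℝ} (hF : ContDiffOn ℝ n F {0}ᶜ) :
    Continuous (fun x : S2 => F x) :=
  hF.continuousOn.comp_continuous continuous_subtype_val sphere_ne_zero

/-- Rotation fields are divergence free on the sphere: this is the infinitesimal form of the
rotation invariance of the surface measure. -/
theorem integral_rotDeriv {F : E3 → ℝ} (hF : ContDiffOn ℝ 1 F {0}ᶜ) (i : Fin 3) :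
    ∫ x : S2, rotDeriv i F x ∂sphMeas = 0 := by
  have hc : ContDiffOn ℝ ((0 : ℕ∞) : WithTop ℕ∞) (rotDeriv i F) {0}ᶜ :=
    contDiffOn_rotDeriv (n := 1) (by exact_mod_cast hF) (by simp) i
  have hF' : ContDiffOn ℝ ((1 : ℕ∞) : WithTop ℕ∞) F {0}ᶜ := by exact_mod_cast hF
  let T : ℝ → E3 ≃ₗᵢ[ℝ] E3 := fun t =>
    LinearIsometry.toLinearIsometryEquiv ⟨(rot i t : E3 →ₗ[ℝ] E3), norm_rot i t⟩ rfl
  have hT : ∀ t (x : S2), ((sphMap (T t) x : S2) : E3) = rot i t x := fun t x => rfl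
  -- Compactness gives the constant bound that dominates the derivative along the flow.
  obtain ⟨C, hC⟩ := (isCompact_univ (X := S2)).exists_bound_of_continuousOn
    hc.continuous_restrict_sphere.continuousOn
  have hder := hasDerivAt_integral_of_dominated_loc_of_deriv_le (μ := sphMeas) (𝕜 := ℝ)
    (F := fun t x => F (sphMap (T t) x)) (F' := fun t x => rotDeriv i F (sphMap (T t) x))
    (x₀ := 0) (s := Set.univ) (bound := fun _ => C) Filter.univ_mem
    (Filter.Eventually.of_forall fun t =>
      (hF'.continuous_restrict_sphere.comp (continuous_sphMap _)).aestronglyMeasurable)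
    (integrable_of_continuous (hF'.continuous_restrict_sphere.comp (continuous_sphMap _)))
    (hc.continuous_restrict_sphere.comp (continuous_sphMap _)).aestronglyMeasurable
    (Filter.Eventually.of_forall fun x t _ => hC _ (Set.mem_univ _))
    (integrable_const C)
    (Filter.Eventually.of_forall fun x t _ => by
      have h1 : HasFDerivAt F _ (rot i t x) := ((hF'.contDiffAt_compl_zero
        (sphere_ne_zero (sphMap (T t) x))).differentiableAt (by simp)).hasFDerivAt
      exact h1.comp_hasDerivAt t (hasDerivAt_rot i x t))
  -- The integral along the flow does not depend on the time.
  have h1 := hder.2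
  have h2 : (fun t => ∫ x, F (sphMap (T t) x) ∂sphMeas) = fun _ => ∫ x : S2, F x ∂sphMeas := by
    funext t
    exact integral_sphMap (T t) (fun x => F x) hF'.continuous_restrict_sphere
  rw [h2] at h1
  have h3 := h1.unique (hasDerivAt_const _ _)
  rw [← h3]
  exact (integral_sphMap (T 0) (fun x => rotDeriv i F x) hc.continuous_restrict_sphere).symm

theorem rotDeriv_mul {F G : E3 → ℝ} {y : E3} (hF : DifferentiableAt ℝ F y)
    (hG : DifferentiableAt ℝ G y) (i : Fin 3) :
    rotDeriv i (fun z => F z * G z) y = F y * rotDeriv i G y + rotDeriv i F y * G y := by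
  simp only [rotDeriv, fderiv_fun_mul hF hG]
  simp [mul_comm]

theorem integral_rotDeriv_mul {F G : E3 → ℝ} (hF : ContDiffOn ℝ 1 F {0}ᶜ)
    (hG : ContDiffOn ℝ 1 G {0}ᶜ) (i : Fin 3) :
    ∫ x : S2, rotDeriv i F x * G x ∂sphMeas = -∫ x : S2, F x * rotDeriv i G x ∂sphMeas := by
  have hF' : ContDiffOn ℝ ((1 : ℕ∞) : WithTop ℕ∞) F {0}ᶜ := by exact_mod_cast hF
  have hG' : ContDiffOn ℝ ((1 : ℕ∞) : WithTop ℕ∞) G {0}ᶜ := by exact_mod_cast hG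
  have h := integral_rotDeriv (hF.mul hG) i
  have h1 : ∀ x : S2, rotDeriv i (fun z => F z * G z) x =
      F x * rotDeriv i G x + rotDeriv i F x * G x := fun x =>
    rotDeriv_mul ((hF'.contDiffAt_compl_zero (sphere_ne_zero x)).differentiableAt (by simp))
      ((hG'.contDiffAt_compl_zero (sphere_ne_zero x)).differentiableAt (by simp)) i
  have c1 := (contDiffOn_rotDeriv (m := 0) hF' (by simp) i).continuous_restrict_sphere
  have c2 := (contDiffOn_rotDeriv (m := 0) hG' (by simp) i).continuous_restrict_sphere
  have c3 := hF'.continuous_restrict_sphere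
  have c4 := hG'.continuous_restrict_sphere
  rw [integral_congr_ae (Filter.Eventually.of_forall h1)] at h
  rw [integral_add (integrable_mul_of_continuous c3 c2) (integrable_mul_of_continuous c1 c4)] at h
  linarith

/-- The square of a rotation field is symmetric for the `L²` pairing on the sphere. -/
theorem integral_rotDeriv_rotDeriv_mul {F G : E3 → ℝ} (hF : ContDiffOn ℝ 2 F {0}ᶜ)
    (hG : ContDiffOn ℝ 2 G {0}ᶜ) (i : Fin 3) :
    ∫ x : S2, rotDeriv i (rotDeriv i F) x * G x ∂sphMeas =
      ∫ x : S2, F x * rotDeriv i (rotDeriv i G) x ∂sphMeas := by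
  have h1 : ContDiffOn ℝ 1 (rotDeriv i F) {0}ᶜ := by
    exact_mod_cast contDiffOn_rotDeriv (m := 1) (n := 2) (by exact_mod_cast hF) (by norm_num) i
  have h2 : ContDiffOn ℝ 1 (rotDeriv i G) {0}ᶜ := by
    exact_mod_cast contDiffOn_rotDeriv (m := 1) (n := 2) (by exact_mod_cast hG) (by norm_num) i
  rw [integral_rotDeriv_mul h1 (hG.of_le (by norm_num)),
    integral_rotDeriv_mul (hF.of_le (by norm_num)) h2, neg_neg]

/-! ### The Laplacian of the sphere in terms of rotation fields -/

theorem contDiffOn_radialExtension {u : S2 → ℝ} (hu : ContMDiff (𝓡 2) 𝓘(ℝ, ℝ) 2 u) :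
    ContDiffOn ℝ 2 (radialExtension u) {0}ᶜ := by
  -- A map into the sphere is only restricted smoothly when it is defined on a whole manifold, so
  -- the punctured space is used as an open submanifold.
  let U : TopologicalSpace.Opens E3 := ⟨{0}ᶜ, isOpen_compl_singleton⟩
  let f : U → E3 := fun y => ‖(y : E3)‖⁻¹ • (y : E3)
  have hf : ContMDiff 𝓘(ℝ, E3) 𝓘(ℝ, E3) 2 f := by
    intro y
    have hy : (y : E3) ≠ 0 := y.2
    have : ContDiffAt ℝ 2 (fun y : E3 => ‖y‖⁻¹ • y) y :=
      ((contDiffAt_norm ℝ hy).inv (norm_ne_zero_iff.2 hy)).smul contDiffAt_id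
    exact contMDiffAt_subtype_iff.2 this.contMDiffAt
  have hf' : ∀ y, f y ∈ Metric.sphere (0 : E3) 1 := fun y => normalize_mem_sphere y.2
  have hg := hu.comp (hf.codRestrict_sphere (n := 2) hf')
  intro y hy
  have h2 : ContMDiffAt 𝓘(ℝ, E3) 𝓘(ℝ, ℝ) 2 (radialExtension u) ((⟨y, hy⟩ : U) : E3) := by
    rw [← contMDiffAt_subtype_iff]
    convert! hg ⟨y, hy⟩ using 1
    funext z
    simp only [radialExtension, Function.comp]
    rw [dif_neg (show (z : E3) ≠ 0 from z.2)]
    rfl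
  exact (contMDiffAt_iff_contDiffAt.1 h2).contDiffWithinAt

theorem radialExtension_coe (u : S2 → ℝ) (x : S2) : radialExtension u x = u x := by
  rw [radialExtension, dif_neg (show (x : E3) ≠ 0 from sphere_ne_zero x)]
  congr 1
  ext1
  simp

theorem radialExtension_smul (u : S2 → ℝ) {t : ℝ} (ht : 0 < t) (y : E3) :
    radialExtension u (t • y) = radialExtension u y := by
  by_cases hy : y = 0
  · simp [hy]
  · rw [radialExtension, radialExtension, dif_neg hy, dif_neg (smul_ne_zero ht.ne' hy)]
    congr 2
    rw [norm_smul, smul_smul, Real.norm_eq_abs, abs_of_pos ht]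
    congr 1
    field_simp

/-- Euler's identity in degree zero. -/
theorem fderiv_apply_self_of_homogeneous {U : E3 → ℝ} (hU : ContDiffOn ℝ 2 U {0}ᶜ)
    (hhom : ∀ t : ℝ, 0 < t → ∀ y, U (t • y) = U y) {y : E3} (hy : y ≠ 0) :
    fderiv ℝ U y y = 0 := by
  have h1 : HasFDerivAt U (fderiv ℝ U y) ((1 : ℝ) • y) := by
    rw [one_smul]
    exact ((hU.contDiffAt (isOpen_compl_singleton.mem_nhds hy)).differentiableAt
      (by simp)).hasFDerivAt
  have h2 : HasDerivAt (fun t : ℝ => t • y) ((1 : ℝ) • y) 1 := (hasDerivAt_id (1 : ℝ)).smul_const y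
  have h3 := h1.comp_hasDerivAt (1 : ℝ) h2
  have h4 : HasDerivAt (fun _ : ℝ => U y) (fderiv ℝ U y ((1 : ℝ) • y)) 1 := by
    refine h3.congr_of_eventuallyEq ?_
    filter_upwards [lt_mem_nhds (zero_lt_one (α := ℝ))] with t ht
    exact (hhom t ht y).symm
  simpa using h4.unique (hasDerivAt_const _ _)

/-- On functions constant along rays, the Euclidean Laplacian at a unit vector is the sum of the
squares of the three rotation fields. -/
theorem laplacian_eq_sum_rotDeriv {U : E3 → ℝ} (hU : ContDiffOn ℝ 2 U {0}ᶜ)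
    (hhom : ∀ t : ℝ, 0 < t → ∀ y, U (t • y) = U y) (x : S2) :
    Laplacian.laplacian U (x : E3) = ∑ i, rotDeriv i (rotDeriv i U) x := by
  have hx : (x : E3) ≠ 0 := sphere_ne_zero x
  have hd : DifferentiableAt ℝ (fderiv ℝ U) x :=
    (((hU.fderiv_of_isOpen (m := 1) isOpen_compl_singleton (by norm_num)).contDiffAt
      (isOpen_compl_singleton.mem_nhds hx))).differentiableAt (by simp)
  have key : ∀ A : E3 →L[ℝ] E3, ∀ v, fderiv ℝ (fun y => fderiv ℝ U y (A y)) x v =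
      fderiv ℝ (fderiv ℝ U) x v (A x) + fderiv ℝ U x (A v) := by
    intro A v
    have h := (hd.hasFDerivAt.clm_apply A.hasFDerivAt).fderiv
    rw [h]
    simp [add_comm]
  -- Differentiating Euler's identity radially kills the second radial derivative.
  have hB : fderiv ℝ (fderiv ℝ U) x x x = 0 := by
    have h0 : (fun y => fderiv ℝ U y (ContinuousLinearMap.id ℝ E3 y)) =ᶠ[nhds (x : E3)]
        fun _ => (0 : ℝ) := by
      filter_upwards [isOpen_compl_singleton.mem_nhds hx] with y hy
      exact fderiv_apply_self_of_homogeneous hU hhom hy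
    have h1 := key (ContinuousLinearMap.id ℝ E3) x
    rw [h0.fderiv_eq] at h1
    simpa [fderiv_apply_self_of_homogeneous hU hhom hx] using h1.symm
  have hsum : ∑ i, rotDeriv i (rotDeriv i U) x =
      ∑ i, fderiv ℝ (fderiv ℝ U) x (rotGen i x) (rotGen i x) := by
    have h1 : ∀ i, rotDeriv i (rotDeriv i U) x =
        fderiv ℝ (fderiv ℝ U) x (rotGen i x) (rotGen i x) + fderiv ℝ U x (rotGen i (rotGen i x)) :=
      fun i => key (rotGen i) (rotGen i x)
    simp only [h1, Finset.sum_add_distrib]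
    rw [← map_sum, sum_rotGen_rotGen, map_smul, fderiv_apply_self_of_homogeneous hU hhom hx]
    simp
  rw [hsum, InnerProductSpace.laplacian_eq_iteratedFDeriv_orthonormalBasis U
    (EuclideanSpace.basisFun (Fin 3) ℝ)]
  simp only [iteratedFDeriv_two_apply, EuclideanSpace.basisFun_apply, Matrix.cons_val_zero,
    Matrix.cons_val_one]
  generalize fderiv ℝ (fderiv ℝ U) (x : E3) = B at hB ⊢
  have hxe : (x : E3) = (x : E3) 0 • EuclideanSpace.single 0 (1 : ℝ) +
      (x : E3) 1 • EuclideanSpace.single 1 (1 : ℝ) +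
      (x : E3) 2 • EuclideanSpace.single 2 (1 : ℝ) := by
    ext j; fin_cases j <;> simp
  have hn : (x : E3) 0 ^ 2 + (x : E3) 1 ^ 2 + (x : E3) 2 ^ 2 = 1 := by
    have := EuclideanSpace.real_norm_sq_eq (x : E3)
    rw [norm_eq_of_mem_sphere, Fin.sum_univ_three] at this
    linarith
  rw [hxe] at hB
  simp only [map_add, map_smul, add_apply, smul_apply,
    smul_eq_mul] at hB
  simp only [rotGen_apply, Fin.sum_univ_three, Fin.reduceAdd, map_sub, map_smul,
    sub_apply, smul_apply, smul_eq_mul, zero_add]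
  linear_combination (-1) * (B (EuclideanSpace.single 0 1) (EuclideanSpace.single 0 1) +
    B (EuclideanSpace.single 1 1) (EuclideanSpace.single 1 1) +
    B (EuclideanSpace.single 2 1) (EuclideanSpace.single 2 1)) * hn + hB

theorem sphereLaplacian_eq_sum_rotDeriv {u : S2 → ℝ} (hu : ContMDiff (𝓡 2) 𝓘(ℝ, ℝ) 2 u) (x : S2) :
    sphereLaplacian u x = ∑ i, rotDeriv i (rotDeriv i (radialExtension u)) x :=
  laplacian_eq_sum_rotDeriv (contDiffOn_radialExtension hu)
    (fun _ ht y => radialExtension_smul u ht y) x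

/-! ### Spherical harmonic decomposition of polynomials -/

/-- Real polynomials in three variables. -/
abbrev Poly3 : Type := MvPolynomial (Fin 3) ℝ

namespace Poly3

open MvPolynomial

/-- The rotation field about the `i`-th axis as a derivation of the polynomial ring. -/
noncomputable def rotDer (i : Fin 3) : Derivation ℝ Poly3 Poly3 :=
  (X (i + 1) : Poly3) • pderiv (i + 2) - (X (i + 2) : Poly3) • pderiv (i + 1)

theorem rotDer_apply (i : Fin 3) (p : Poly3) :
    rotDer i p = X (i + 1) * pderiv (i + 2) p - X (i + 2) * pderiv (i + 1) p := rfl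

/-- The spherical Laplacian on polynomials: the sum of the squares of the rotation fields. -/
noncomputable def sphLap : Poly3 →ₗ[ℝ] Poly3 :=
  ∑ i, (rotDer i : Poly3 →ₗ[ℝ] Poly3) ∘ₗ (rotDer i : Poly3 →ₗ[ℝ] Poly3)

theorem sphLap_apply (p : Poly3) : sphLap p = ∑ i, rotDer i (rotDer i p) := by
  simp [sphLap]

/-- The Euclidean Laplacian on polynomials. -/
noncomputable def lap : Poly3 →ₗ[ℝ] Poly3 :=
  ∑ i, ((pderiv i : Derivation ℝ Poly3 Poly3) : Poly3 →ₗ[ℝ] Poly3) ∘ₗ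
    ((pderiv i : Derivation ℝ Poly3 Poly3) : Poly3 →ₗ[ℝ] Poly3)

theorem lap_apply (p : Poly3) : lap p = ∑ i, pderiv i (pderiv i p) := by
  simp [lap]

/-- The polynomial `x² + y² + z²`. -/
noncomputable def normSq : Poly3 := ∑ i, X i ^ 2

theorem normSq_ne_zero : normSq ≠ 0 := by
  intro h
  have := congrArg (eval (fun _ => (1 : ℝ))) h
  simp [normSq] at this

theorem eval_normSq (x : S2) : eval (x : E3) normSq = 1 := by
  have := EuclideanSpace.real_norm_sq_eq (x : E3)
  rw [norm_eq_of_mem_sphere] at this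
  simp [normSq, ← this]

theorem isHomogeneous_normSq : normSq.IsHomogeneous 2 :=
  IsHomogeneous.sum _ _ _ fun i _ => by simpa using (isHomogeneous_X ℝ i).pow 2

theorem rotDer_normSq (i : Fin 3) : rotDer i normSq = 0 := by
  fin_cases i <;>
  · simp [rotDer_apply, normSq, Fin.sum_univ_three, pderiv_X]
    ring

theorem sphLap_normSq_mul (p : Poly3) : sphLap (normSq * p) = normSq * sphLap p := by
  simp [sphLap_apply, Derivation.leibniz, rotDer_normSq, Finset.mul_sum]

theorem lap_isHomogeneous {p : Poly3} {k : ℕ} (hp : p.IsHomogeneous (k + 2)) :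
    (lap p).IsHomogeneous k := by
  rw [lap_apply]
  exact IsHomogeneous.sum _ _ _ fun i _ => (hp.pderiv (i := i)).pderiv

theorem pderiv_pderiv_comm (i j : Fin 3) (p : Poly3) :
    pderiv i (pderiv j p) = pderiv j (pderiv i p) := by
  have h : ⁅pderiv (R := ℝ) i, pderiv (R := ℝ) j⁆ = (0 : Derivation ℝ Poly3 Poly3) := by
    refine derivation_ext fun l => ?_
    rw [Derivation.commutator_apply, pderiv_X, pderiv_X]
    simp only [Pi.single_apply]
    split_ifs <;> simp
  have h1 := congrArg (fun D : Derivation ℝ Poly3 Poly3 => D p) h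
  simpa [Derivation.commutator_apply, sub_eq_zero] using h1

/-- Polar coordinates for the Laplacian, on homogeneous polynomials. -/
theorem sphLap_of_isHomogeneous {p : Poly3} {k : ℕ} (hp : p.IsHomogeneous k) :
    sphLap p = normSq * lap p - ((k : ℝ) * (k + 1)) • p := by
  have e1 := hp.sum_X_mul_pderiv
  have e2 : ∀ j, pderiv j (∑ i, X i * pderiv i p) = pderiv j (k • p) := fun j => by rw [e1]
  have f0 := e2 0
  have f1 := e2 1
  have f2 := e2 2
  have c01 := pderiv_pderiv_comm 0 1 p
  have c02 := pderiv_pderiv_comm 0 2 p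
  have c12 := pderiv_pderiv_comm 1 2 p
  clear e2
  have h10 : pderiv (R := ℝ) 1 (X 0 : Poly3) = 0 := pderiv_X_of_ne (by decide)
  have h20 : pderiv (R := ℝ) 2 (X 0 : Poly3) = 0 := pderiv_X_of_ne (by decide)
  have h01 : pderiv (R := ℝ) 0 (X 1 : Poly3) = 0 := pderiv_X_of_ne (by decide)
  have h21 : pderiv (R := ℝ) 2 (X 1 : Poly3) = 0 := pderiv_X_of_ne (by decide)
  have h02 : pderiv (R := ℝ) 0 (X 2 : Poly3) = 0 := pderiv_X_of_ne (by decide)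
  have h12 : pderiv (R := ℝ) 1 (X 2 : Poly3) = 0 := pderiv_X_of_ne (by decide)
  simp only [Fin.sum_univ_three, map_add, Derivation.leibniz, h10, h20, h01, h21, h02, h12,
    pderiv_X_self, smul_eq_mul, nsmul_eq_mul, Derivation.map_natCast] at e1 f0 f1 f2
  simp only [sphLap_apply, lap_apply, normSq, rotDer_apply, Fin.sum_univ_three, map_sub,
    Derivation.leibniz, Fin.reduceAdd, zero_add, h10, h20, h01, h21, h02, h12,
    pderiv_X_self, smul_eq_mul, smul_eq_C_mul, map_mul, map_add, map_natCast, map_one]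
  rw [c01, c02, c12] at *
  linear_combination (-1 : Poly3) * (X 0 * f0 + X 1 * f1 + X 2 * f2) - ((k : Poly3) + 1) * e1

/-- Homogeneous polynomials of degree `k` that are eigenvectors of the spherical Laplacian for the
eigenvalue `-j (j + 1)` and agree on the sphere with a harmonic homogeneous polynomial of
degree `j`. -/
def harmonicPart (k j : ℕ) : Submodule ℝ Poly3 where
  carrier := {p | p.IsHomogeneous k ∧ sphLap p = (-((j : ℝ) * (j + 1))) • p ∧
    ∃ h : Poly3, h.IsHomogeneous j ∧ lap h = 0 ∧ ∀ x : S2, eval (x : E3) p = eval (x : E3) h}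
  zero_mem' := ⟨isHomogeneous_zero _ _ _, by simp, 0, isHomogeneous_zero _ _ _, by simp, by simp⟩
  add_mem' := by
    rintro p q ⟨hp, hp', h, hh, hl, he⟩ ⟨hq, hq', g, hg, hm, hf⟩
    exact ⟨hp.add hq, by rw [map_add, hp', hq', smul_add], h + g, hh.add hg,
      by rw [map_add, hl, hm, add_zero], fun x => by rw [map_add, map_add, he, hf]⟩
  smul_mem' := by
    rintro c p ⟨hp, hp', h, hh, hl, he⟩
    have hom : ∀ {n : ℕ} {q : Poly3}, q.IsHomogeneous n → (c • q).IsHomogeneous n := by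
      intro n q hq
      exact (homogeneousSubmodule (Fin 3) ℝ n).smul_mem c hq
    exact ⟨hom hp, by rw [map_smul, hp', smul_comm], c • h, hom hh,
      by rw [map_smul, hl, smul_zero], fun x => by rw [smul_eval, smul_eval, he]⟩

theorem normSq_mul_mem_harmonicPart {k j : ℕ} {p : Poly3} (hp : p ∈ harmonicPart k j) :
    normSq * p ∈ harmonicPart (k + 2) j := by
  obtain ⟨hp, hp', h, hh, hl, he⟩ := hp
  refine ⟨?_, by rw [sphLap_normSq_mul, hp', mul_smul_comm], h, hh, hl, fun x => ?_⟩
  · rw [add_comm]; exact isHomogeneous_normSq.mul hp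
  · rw [map_mul, eval_normSq, one_mul, he]

theorem mem_harmonicPart_of_lap_eq_zero {k : ℕ} {p : Poly3} (hp : p.IsHomogeneous k)
    (h : lap p = 0) : p ∈ harmonicPart k k :=
  ⟨hp, by rw [sphLap_of_isHomogeneous hp, h, mul_zero, zero_sub, neg_smul], p, hp, h, fun _ => rfl⟩

theorem lap_eq_zero_of_isHomogeneous_lt_two {p : Poly3} {k : ℕ} (hp : p.IsHomogeneous k)
    (hk : k < 2) :
    lap p = 0 := by
  rw [lap_apply]
  refine Finset.sum_eq_zero fun i _ => ?_
  have h0 : (pderiv i p).IsHomogeneous 0 := by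
    have := hp.pderiv (i := i)
    rwa [show k - 1 = 0 by omega] at this
  rw [← totalDegree_zero_iff_isHomogeneous, totalDegree_eq_zero_iff_eq_C] at h0
  rw [h0, pderiv_C]

/-- The canonical decomposition of a homogeneous polynomial into products of powers of `|x|²` and
harmonic polynomials. If `q = Δp` is already decomposed as `∑ eⱼ`, then subtracting suitable
multiples of the `|x|² eⱼ` from `p` leaves a harmonic polynomial, because `-k (k + 1)` is not among
the eigenvalues `-j (j + 1)` with `j ≤ k - 2`. -/
theorem exists_sum_harmonicPart (k : ℕ) : ∀ p : Poly3, p.IsHomogeneous k →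
    ∃ e : ℕ → Poly3, (∀ j, e j ∈ harmonicPart k j) ∧ p = ∑ j ∈ Finset.range (k + 1), e j := by
  induction k using Nat.strong_induction_on with
  | _ k ih =>
    intro p hp
    by_cases hk : k < 2
    · refine ⟨fun j => if j = k then p else 0, fun j => ?_, by simp⟩
      dsimp only
      split_ifs with h
      · subst h
        exact mem_harmonicPart_of_lap_eq_zero hp (lap_eq_zero_of_isHomogeneous_lt_two hp hk)
      · exact Submodule.zero_mem _
    · obtain ⟨k, rfl⟩ : ∃ m, k = m + 2 := ⟨k - 2, by omega⟩
      obtain ⟨e, he, hsum⟩ := ih k (by omega) (lap p) (lap_isHomogeneous hp)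
      set c : ℕ → ℝ := fun j => (((k + 2 : ℕ) : ℝ) * ((k + 2 : ℕ) + 1) - j * (j + 1))⁻¹ with hc
      set f : ℕ → Poly3 := fun j => c j • (normSq * e j) with hf
      have hfm : ∀ j, f j ∈ harmonicPart (k + 2) j := fun j =>
        Submodule.smul_mem _ _ (normSq_mul_mem_harmonicPart (he j))
      set r : Poly3 := p - ∑ j ∈ Finset.range (k + 1), f j with hr
      have hrh : r.IsHomogeneous (k + 2) :=
        hp.sub (IsHomogeneous.sum _ _ _ fun j _ => (hfm j).1)
      have hfl : ∀ j ∈ Finset.range (k + 1), sphLap (f j) =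
          normSq * e j - (((k + 2 : ℕ) : ℝ) * ((k + 2 : ℕ) + 1)) • f j := by
        intro j hj
        have hj' : (j : ℝ) ≤ k := by
          have := Finset.mem_range.1 hj
          exact_mod_cast Nat.lt_succ_iff.1 this
        have hj0 : (0 : ℝ) ≤ j := Nat.cast_nonneg j
        have hne : ((k + 2 : ℕ) : ℝ) * ((k + 2 : ℕ) + 1) - j * (j + 1) ≠ 0 := by
          push_cast
          nlinarith
        have h1 : normSq * e j = (((k + 2 : ℕ) : ℝ) * ((k + 2 : ℕ) + 1) - j * (j + 1)) • f j := by
          rw [hf, hc]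
          dsimp only
          rw [smul_smul, mul_inv_cancel₀ hne, one_smul]
        rw [(hfm j).2.1, h1]
        module
      have hrl : sphLap r = -(((k + 2 : ℕ) : ℝ) * ((k + 2 : ℕ) + 1)) • r := by
        rw [hr, map_sub, map_sum, Finset.sum_congr rfl hfl, Finset.sum_sub_distrib,
          ← Finset.mul_sum, ← hsum, ← Finset.smul_sum, sphLap_of_isHomogeneous hp]
        module
      have hr0 : lap r = 0 := by
        rw [sphLap_of_isHomogeneous hrh] at hrl
        have : normSq * lap r = 0 := by 
          rw [neg_smul] at hrl
          exact add_right_cancel ((sub_eq_add_neg _ _).symm.trans (hrl.trans (zero_add _).symm))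
        exact (mul_eq_zero.1 this).resolve_left normSq_ne_zero
      refine ⟨fun j => if j < k + 1 then f j else if j = k + 2 then r else 0, fun j => ?_, ?_⟩
      · dsimp only
        split_ifs with h1 h2
        · exact hfm j
        · subst h2
          exact mem_harmonicPart_of_lap_eq_zero hrh hr0
        · exact Submodule.zero_mem _
      · rw [Finset.sum_range_succ, Finset.sum_range_succ]
        rw [Finset.sum_congr rfl fun j hj => if_pos (Finset.mem_range.1 hj)]
        simp [hr]

/-- Polynomials representing spherical harmonics of degree `j`. -/
noncomputable def sphericalHarmonic (j : ℕ) : Submodule ℝ Poly3 := ⨆ k, harmonicPart k j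

theorem sphLap_of_mem_harmonic {j : ℕ} {p : Poly3} (hp : p ∈ sphericalHarmonic j) :
    sphLap p = (-((j : ℝ) * (j + 1))) • p := by
  induction hp using Submodule.iSup_induction' with
  | mem k p hp => exact hp.2.1
  | zero => simp
  | add p q _ _ hp hq => rw [map_add, hp, hq, smul_add]

theorem exists_harmonic_representative {j : ℕ} {p : Poly3} (hp : p ∈ sphericalHarmonic j) :
    ∃ h : Poly3, h.IsHomogeneous j ∧ lap h = 0 ∧ ∀ x : S2, eval (x : E3) p = eval (x : E3) h := by
  induction hp using Submodule.iSup_induction' with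
  | mem k p hp => exact hp.2.2
  | zero => exact ⟨0, isHomogeneous_zero _ _ _, by simp, by simp⟩
  | add p q _ _ hp hq =>
    obtain ⟨h, hh, hl, he⟩ := hp
    obtain ⟨g, hg, hm, hf⟩ := hq
    exact ⟨h + g, hh.add hg, by rw [map_add, hl, hm, add_zero],
      fun x => by rw [map_add, map_add, he, hf]⟩

theorem exists_sum_harmonic (p : Poly3) :
    ∃ (s : Finset ℕ) (e : ℕ → Poly3), (∀ j, e j ∈ sphericalHarmonic j) ∧ p = ∑ j ∈ s, e j := by
  have h : p ∈ ⨆ j, sphericalHarmonic j := by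
    rw [← sum_homogeneousComponent p]
    refine Submodule.sum_mem _ fun k _ => ?_
    obtain ⟨e, he, hs⟩ := exists_sum_harmonicPart k _ (homogeneousComponent_isHomogeneous k p)
    rw [hs]
    exact Submodule.sum_mem _ fun j _ =>
      Submodule.mem_iSup_of_mem j (Submodule.mem_iSup_of_mem k (he j))
  classical
  obtain ⟨f, hf⟩ := (Submodule.mem_iSup_iff_exists_dfinsupp' _ p).1 h
  exact ⟨f.support, fun j => f j, fun j => (f j).2, hf.symm⟩

/-- The quadratic form of a matrix as a polynomial. -/
noncomputable def quad (A : Matrix (Fin 3) (Fin 3) ℝ) : Poly3 :=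
  ∑ i, ∑ j, C (A i j) * (X i * X j)

theorem eval_quad (A : Matrix (Fin 3) (Fin 3) ℝ) (x : Fin 3 → ℝ) :
    eval x (quad A) = ∑ i, ∑ j, A i j * (x i * x j) := by
  simp [quad]

theorem isHomogeneous_quad (A : Matrix (Fin 3) (Fin 3) ℝ) : (quad A).IsHomogeneous 2 :=
  IsHomogeneous.sum _ _ _ fun i _ => IsHomogeneous.sum _ _ _ fun j _ => by
    simpa using (isHomogeneous_C (Fin 3) (A i j)).mul
      ((isHomogeneous_X ℝ i).mul (isHomogeneous_X ℝ j))

theorem lap_quad (A : Matrix (Fin 3) (Fin 3) ℝ) : lap (quad A) = C (2 * A.trace) := by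
  simp [lap_apply, quad, Fin.sum_univ_three, Matrix.trace, pderiv_X, Pi.single_apply]
  rw [show (C (2 : ℝ) : Poly3) = 2 from map_ofNat C 2]
  ring

/-- Harmonic quadratic forms are the forms of symmetric traceless matrices. -/
theorem exists_eq_quad {h : Poly3} (hh : h.IsHomogeneous 2) (hl : lap h = 0) :
    ∃ A : Matrix (Fin 3) (Fin 3) ℝ, A.IsSymm ∧ A.trace = 0 ∧ h = quad A := by
  have h0 : ∀ i j, ∃ a : ℝ, pderiv i (pderiv j h) = C a := by
    intro i j
    have h0 : (pderiv i (pderiv j h)).IsHomogeneous 0 := (hh.pderiv (i := j)).pderiv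
    rw [← totalDegree_zero_iff_isHomogeneous, totalDegree_eq_zero_iff_eq_C] at h0
    exact ⟨_, h0⟩
  choose a ha using h0
  have hq : h = quad (Matrix.of fun i j => a i j / 2) := by
    have e1 := hh.sum_X_mul_pderiv
    have e2 : ∀ j, ∑ i, X i * pderiv i (pderiv j h) = 1 • pderiv j h :=
      fun j => (hh.pderiv (i := j)).sum_X_mul_pderiv
    simp only [ha, one_smul] at e2
    simp only [← e2] at e1
    have h2 : (C (2 : ℝ) : Poly3) * h = C 2 * quad (Matrix.of fun i j => a i j / 2) := by
      have hC : ∀ i j, (C (a i j) : Poly3) = C 2 * C (a i j / 2) := fun i j => by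
        rw [← C_mul]; congr 1; ring
      simp only [hC, Fin.sum_univ_three, nsmul_eq_mul, Nat.cast_ofNat] at e1
      simp only [quad, Fin.sum_univ_three, Matrix.of_apply]
      rw [show (C (2 : ℝ) : Poly3) = 2 from map_ofNat C 2] at e1 ⊢
      linear_combination -e1
    exact mul_left_cancel₀ (by simp) h2
  refine ⟨_, ?_, ?_, hq⟩
  · ext i j
    have := pderiv_pderiv_comm i j h
    rw [ha, ha] at this
    simp [C_injective _ _ this]
  · rw [hq, lap_quad] at hl
    have := (C_eq_zero (R := ℝ) (σ := Fin 3)).1 hl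
    linarith

end Poly3

/-! ### Polynomials as functions on the sphere -/

namespace Poly3

open MvPolynomial

theorem hasFDerivAt_eval (p : Poly3) (y : E3) :
    HasFDerivAt (fun z : E3 => eval z p)
      (∑ i, eval y (pderiv i p) • (EuclideanSpace.proj i : E3 →L[ℝ] ℝ)) y := by
  induction p using MvPolynomial.induction_on with
  | C a => simpa using hasFDerivAt_const (𝕜 := ℝ) a y
  | add p q hp hq =>
    simp only [map_add, add_smul, Finset.sum_add_distrib]
    exact hp.add hq
  | mul_X p j hp =>
    have hX : HasFDerivAt (fun z : E3 => z j) (EuclideanSpace.proj j : E3 →L[ℝ] ℝ) y :=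
      (EuclideanSpace.proj j : E3 →L[ℝ] ℝ).hasFDerivAt
    have h := hp.mul hX
    simp only [map_mul, eval_X]
    convert! h using 1
    simp only [Derivation.leibniz, pderiv_X, smul_eq_mul, map_add, map_mul, eval_X, add_smul,
      Finset.sum_add_distrib, Finset.smul_sum, smul_smul]
    congr 1
    rw [Finset.sum_eq_single j]
    · simp
    · intro i _ hij
      simp [hij.symm]
    · simp

theorem contDiff_eval (p : Poly3) {n : WithTop ℕ∞} : ContDiff ℝ n (fun z : E3 => eval z p) := by
  induction p using MvPolynomial.induction_on with
  | C a => simpa using contDiff_const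
  | add p q hp hq => simpa using hp.add hq
  | mul_X p j hp =>
    simp only [map_mul, eval_X]
    exact hp.mul (EuclideanSpace.proj j : E3 →L[ℝ] ℝ).contDiff

theorem rotDeriv_eval (p : Poly3) (i : Fin 3) :
    rotDeriv i (fun z : E3 => eval z p) = fun z : E3 => eval z (rotDer i p) := by
  funext y
  rw [rotDeriv, (hasFDerivAt_eval p y).fderiv, rotDer_apply]
  fin_cases i <;> simp [rotGen_apply, Fin.sum_univ_three] <;> ring

theorem integral_rotDer (i : Fin 3) (p : Poly3) :
    ∫ x : S2, eval (x : E3) (rotDer i p) ∂sphMeas = 0 := by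
  have h := integral_rotDeriv (contDiff_eval p).contDiffOn i
  rwa [rotDeriv_eval] at h

theorem rotDeriv_rotDeriv_eval (p : Poly3) (i : Fin 3) :
    rotDeriv i (rotDeriv i (fun z : E3 => eval z p)) =
      fun z : E3 => eval z (rotDer i (rotDer i p)) := by
  rw [rotDeriv_eval, rotDeriv_eval]

/-- The restriction of polynomials to the unit sphere. -/
noncomputable def toSphere : Poly3 →ₐ[ℝ] C(S2, ℝ) :=
  aeval fun i => ⟨fun x => (x : E3) i,
    (EuclideanSpace.proj i : E3 →L[ℝ] ℝ).continuous.comp continuous_subtype_val⟩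

theorem toSphere_apply (p : Poly3) (x : S2) : toSphere p x = eval (x : E3) p := by
  induction p using MvPolynomial.induction_on with
  | C a => simp [toSphere]
  | add p q hp hq => simp [hp, hq]
  | mul_X p j hp =>
    have hX : toSphere (X j) x = (x : E3) j := by
      rw [toSphere, aeval_X]
      rfl
    simp [hp, hX]

theorem continuous_eval_sphere (p : Poly3) : Continuous fun x : S2 => eval (x : E3) p := by
  exact (toSphere p).continuous.congr fun x => toSphere_apply p x

theorem denseRange_toSphere : DenseRange toSphere := by
  have h : (toSphere.range).SeparatesPoints := by
    intro x y hxy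
    have : ∃ i, (x : E3) i ≠ (y : E3) i := by
      by_contra! h
      exact hxy (Subtype.ext (PiLp.ext h))
    obtain ⟨i, hi⟩ := this
    refine ⟨toSphere (X i), ⟨toSphere (X i), ⟨X i, rfl⟩, rfl⟩, ?_⟩
    simpa [toSphere_apply] using hi
  have h1 := ContinuousMap.subalgebra_topologicalClosure_eq_top_of_separatesPoints _ h
  intro f
  have h2 : f ∈ (toSphere.range).topologicalClosure := by rw [h1]; trivial
  exact h2

/-- Symmetry of the Laplacian, tested against polynomials. -/
theorem integral_sphereLaplacian_mul {u : S2 → ℝ} (hu : ContMDiff (𝓡 2) 𝓘(ℝ, ℝ) 2 u) (p : Poly3) :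
    ∫ x : S2, sphereLaplacian u x * eval (x : E3) p ∂sphMeas =
      ∫ x : S2, u x * eval (x : E3) (sphLap p) ∂sphMeas := by
  have hU := contDiffOn_radialExtension hu
  have hU' : ContDiffOn ℝ ((2 : ℕ∞) : WithTop ℕ∞) (radialExtension u) {0}ᶜ := by exact_mod_cast hU
  have c1 : ∀ i, Continuous fun x : S2 => rotDeriv i (rotDeriv i (radialExtension u)) x :=
    fun i => (contDiffOn_rotDeriv (m := 0) (n := 1)
      (contDiffOn_rotDeriv hU' (by norm_num) i) (by norm_num) i).continuous_restrict_sphere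
  have c2 : Continuous u := hu.continuous
  have h1 : ∀ x : S2, sphereLaplacian u x * eval (x : E3) p =
      ∑ i, rotDeriv i (rotDeriv i (radialExtension u)) x * eval (x : E3) p := fun x => by
    rw [sphereLaplacian_eq_sum_rotDeriv hu, Finset.sum_mul]
  have h2 : ∀ x : S2, u x * eval (x : E3) (sphLap p) =
      ∑ i, u x * eval (x : E3) (rotDer i (rotDer i p)) := fun x => by
    rw [sphLap_apply, map_sum, Finset.mul_sum]
  simp only [h1, h2]
  rw [integral_finsetSum _ fun i _ => integrable_mul_of_continuous
      (c1 i) (continuous_eval_sphere p),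
    integral_finsetSum _ fun i _ => integrable_mul_of_continuous
      c2 (continuous_eval_sphere _)]
  refine Finset.sum_congr rfl fun i _ => ?_
  have h3 := integral_rotDeriv_rotDeriv_mul hU (contDiff_eval p).contDiffOn i
  simpa only [rotDeriv_rotDeriv_eval, radialExtension_coe] using h3

theorem integral_sphLap_mul (p q : Poly3) :
    ∫ x : S2, eval (x : E3) (sphLap p) * eval (x : E3) q ∂sphMeas =
      ∫ x : S2, eval (x : E3) p * eval (x : E3) (sphLap q) ∂sphMeas := by
  simp only [sphLap_apply, map_sum, Finset.mul_sum, Finset.sum_mul]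
  rw [integral_finsetSum _ fun i _ => integrable_mul_of_continuous
      (continuous_eval_sphere _) (continuous_eval_sphere _),
    integral_finsetSum _ fun i _ => integrable_mul_of_continuous
      (continuous_eval_sphere _) (continuous_eval_sphere _)]
  refine Finset.sum_congr rfl fun i _ => ?_
  have h3 := integral_rotDeriv_rotDeriv_mul (contDiff_eval p).contDiffOn
    (contDiff_eval q).contDiffOn i
  simpa only [rotDeriv_rotDeriv_eval] using h3

theorem integral_harmonic_mul_harmonic {j k : ℕ} (hjk : j ≠ k) {p q : Poly3}
    (hp : p ∈ sphericalHarmonic j) (hq : q ∈ sphericalHarmonic k) :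
    ∫ x : S2, eval (x : E3) p * eval (x : E3) q ∂sphMeas = 0 := by
  have h := integral_sphLap_mul p q
  rw [sphLap_of_mem_harmonic hp, sphLap_of_mem_harmonic hq] at h
  simp only [smul_eval, mul_assoc, mul_left_comm _ (-((k : ℝ) * (k + 1)))] at h
  rw [integral_const_mul, integral_const_mul] at h
  have hne : -((j : ℝ) * (j + 1)) - -((k : ℝ) * (k + 1)) ≠ 0 := by
    have h1 : (j : ℝ) ≠ k := by exact_mod_cast hjk
    have h2 : (j : ℝ) + k + 1 ≠ 0 := by positivity
    have h3 : -((j : ℝ) * (j + 1)) - -((k : ℝ) * (k + 1)) = (k - j) * (j + k + 1) := by ring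
    rw [h3]
    exact mul_ne_zero (sub_ne_zero.2 h1.symm) h2
  refine (mul_eq_zero.1 ?_).resolve_left hne
  rw [sub_mul, h, sub_self]

end Poly3

/-! ### The spectral gap estimate -/

/-- If `w` arises from `f` by a diagonal operator with coefficients bounded by `C` relative to an
orthogonal family of subspaces with dense span, then `‖w‖ ≤ C ‖f‖`. -/
theorem norm_le_of_inner_eq_mul_inner {V : Type*} [NormedAddCommGroup V] [InnerProductSpace ℝ V]
    {E : ℕ → Submodule ℝ V} (hE : OrthogonalFamily ℝ (fun j => E j) fun j => (E j).subtypeₗᵢ)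
    {D : Set V} (hD : Dense D)
    (hDE : ∀ g ∈ D, ∃ (s : Finset ℕ) (e : ∀ j, E j), g = ∑ j ∈ s, (e j : V))
    {w f : V} {c : ℕ → ℝ} {C : ℝ} (hc : ∀ j, |c j| ≤ C)
    (h : ∀ j, ∀ e ∈ E j, inner ℝ w e = c j * inner ℝ f e) : ‖w‖ ≤ C * ‖f‖ := by
  have hC : 0 ≤ C := (abs_nonneg _).trans (hc 0)
  have key : ∀ g ∈ D, inner ℝ w g ≤ C * ‖f‖ * ‖g‖ := by
    intro g hg
    obtain ⟨s, e, rfl⟩ := hDE g hg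
    have h1 : inner ℝ w (∑ j ∈ s, (e j : V)) = inner ℝ f (∑ j ∈ s, c j • (e j : V)) := by
      simp only [inner_sum, inner_smul_right, h _ _ (e _).2]
    have h2 : ‖∑ j ∈ s, (e j : V)‖ ^ 2 = ∑ j ∈ s, ‖e j‖ ^ 2 := hE.norm_sum e s
    have h3 : ‖∑ j ∈ s, c j • (e j : V)‖ ^ 2 = ∑ j ∈ s, ‖c j • e j‖ ^ 2 :=
      hE.norm_sum (fun j => c j • e j) s
    have h4 : ‖∑ j ∈ s, c j • (e j : V)‖ ≤ C * ‖∑ j ∈ s, (e j : V)‖ := by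
      refine le_of_sq_le_sq ?_ (by positivity)
      rw [mul_pow, h2, h3, Finset.mul_sum]
      refine Finset.sum_le_sum fun j _ => ?_
      rw [norm_smul, mul_pow, Real.norm_eq_abs]
      gcongr
      exact hc j
    rw [h1]
    calc _ ≤ ‖f‖ * ‖∑ j ∈ s, c j • (e j : V)‖ := real_inner_le_norm _ _
      _ ≤ ‖f‖ * (C * ‖∑ j ∈ s, (e j : V)‖) := by gcongr
      _ = _ := by ring
  have hcl : IsClosed {g : V | inner ℝ w g ≤ C * ‖f‖ * ‖g‖} :=
    isClosed_le (by fun_prop) (by fun_prop)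
  have hw : inner ℝ w w ≤ C * ‖f‖ * ‖w‖ := hcl.closure_subset_iff.2 key (hD w)
  rw [real_inner_self_eq_norm_mul_norm] at hw
  by_cases h0 : ‖w‖ = 0
  · rw [h0]; positivity
  · exact le_of_mul_le_mul_right hw (lt_of_le_of_ne (norm_nonneg _) (Ne.symm h0))

open Poly3 in
/-- A `C²` function `u` differs from a harmonic quadratic form by at most `1/4` of the size of
`Δu + 6u` in the mean square, as `4` is the distance from `-6` to the other eigenvalues
`-j (j + 1)`. -/
theorem exists_harmonic_quad_close {u f : S2 → ℝ} (hu : ContMDiff (𝓡 2) 𝓘(ℝ, ℝ) 2 u)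
    (hf : Continuous f) (huf : ∀ x, sphereLaplacian u x + 6 * u x = f x) :
    ∃ A : Matrix (Fin 3) (Fin 3) ℝ, A.IsSymm ∧ A.trace = 0 ∧
      ∫ x : S2, (u x - MvPolynomial.eval (x : E3) (quad A)) ^ 2 ∂sphMeas ≤
        1 / 16 * ∫ x : S2, f x ^ 2 ∂sphMeas := by
  let ι : C(S2, ℝ) →L[ℝ] Lp ℝ 2 sphMeas := ContinuousMap.toLp 2 sphMeas ℝ
  have hinner : ∀ g h : C(S2, ℝ), inner ℝ (ι g) (ι h) = ∫ x, g x * h x ∂sphMeas := by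
    intro g h
    rw [ContinuousMap.inner_toLp]
    simp [mul_comm]
  let P : Poly3 →ₗ[ℝ] Lp ℝ 2 sphMeas := ι.toLinearMap ∘ₗ toSphere.toLinearMap
  have hP : ∀ p, P p = ι (toSphere p) := fun _ => rfl
  let E : ℕ → Submodule ℝ (Lp ℝ 2 sphMeas) := fun j => (sphericalHarmonic j).map P
  have hE : OrthogonalFamily ℝ (fun j => E j) fun j => (E j).subtypeₗᵢ := by
    rintro j k hjk ⟨_, p, hp, rfl⟩ ⟨_, q, hq, rfl⟩
    change inner ℝ (ι (toSphere p)) (ι (toSphere q)) = 0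
    rw [hinner]
    simp only [toSphere_apply]
    exact integral_harmonic_mul_harmonic hjk hp hq
  have hD : Dense (Set.range P) :=
    (ContinuousMap.toLp_denseRange ℝ sphMeas ℝ (by simp)).comp denseRange_toSphere ι.continuous
  have hDE : ∀ g ∈ Set.range P, ∃ (s : Finset ℕ) (e : ∀ j, E j), g = ∑ j ∈ s, (e j : _) := by
    rintro _ ⟨p, rfl⟩
    obtain ⟨s, e, he, rfl⟩ := exists_sum_harmonic p
    exact ⟨s, fun j => ⟨P (e j), e j, he j, rfl⟩, map_sum P _ _⟩
  have hfin : FiniteDimensional ℝ (E 2) := by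
    have hle : E 2 ≤ Submodule.span ℝ (Set.range fun ij : Fin 3 × Fin 3 =>
        P (MvPolynomial.X ij.1 * MvPolynomial.X ij.2)) := by
      rintro _ ⟨p, hp, rfl⟩
      obtain ⟨h, hh, hl, he⟩ := exists_harmonic_representative hp
      obtain ⟨A, -, -, rfl⟩ := exists_eq_quad hh hl
      have : P p = P (quad A) := by
        rw [hP, hP]
        congr 1
        ext x
        rw [toSphere_apply, toSphere_apply, he]
      rw [this, quad, map_sum]
      refine Submodule.sum_mem _ fun i _ => ?_
      rw [map_sum]
      refine Submodule.sum_mem _ fun j _ => ?_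
      rw [← MvPolynomial.smul_eq_C_mul, map_smul]
      exact Submodule.smul_mem _ _ (Submodule.subset_span ⟨(i, j), rfl⟩)
    have := FiniteDimensional.span_of_finite ℝ (Set.finite_range fun ij : Fin 3 × Fin 3 =>
        P (MvPolynomial.X ij.1 * MvPolynomial.X ij.2))
    exact Submodule.finiteDimensional_of_le hle
  have gap : ∀ j : ℕ, j ≠ 2 → 6 - (j : ℝ) * (j + 1) ≠ 0 ∧ 4 ≤ |6 - (j : ℝ) * (j + 1)| := by
    intro j hj
    rcases lt_or_gt_of_ne hj with h | h
    · interval_cases j <;> norm_num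
    · have h3 : (3 : ℝ) ≤ j := by exact_mod_cast h
      have h4 : 6 - (j : ℝ) * (j + 1) ≤ -4 := by nlinarith
      exact ⟨by linarith, by rw [abs_of_neg (by linarith)]; linarith⟩
  let uC : C(S2, ℝ) := ⟨u, hu.continuous⟩
  let fC : C(S2, ℝ) := ⟨f, hf⟩
  obtain ⟨p, hp, hpφ⟩ := (E 2).starProjection_apply_mem (ι uC)
  obtain ⟨h, hh, hl, he⟩ := exists_harmonic_representative hp
  obtain ⟨A, hA, htr, rfl⟩ := exists_eq_quad hh hl
  have hproj : (E 2).starProjection (ι uC) = ι (toSphere p) := hpφ.symm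
  have hnorm : ∀ g : C(S2, ℝ), ‖ι g‖ ^ 2 = ∫ x, g x ^ 2 ∂sphMeas := by
    intro g
    rw [← real_inner_self_eq_norm_sq, hinner]
    simp only [sq]
  -- The diagonal relation: the coefficient `0` at degree `2` records the choice of the projection.
  have hdiag : ∀ j, ∀ e ∈ E j, inner ℝ (ι uC - (E 2).starProjection (ι uC)) e =
      (if j = 2 then 0 else (6 - (j : ℝ) * (j + 1))⁻¹) * inner ℝ (ι fC) e := by
    intro j e he
    split_ifs with hj
    · subst hj
      rw [zero_mul]
      exact (E 2).starProjection_inner_eq_zero (ι uC) e he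
    · have h0 : inner ℝ ((E 2).starProjection (ι uC)) e = 0 :=
        hE (Ne.symm hj) ⟨_, (E 2).starProjection_apply_mem (ι uC)⟩ ⟨e, he⟩
      obtain ⟨q, hq, rfl⟩ := he
      rw [inner_sub_left, h0, sub_zero, hP, hinner, hinner]
      have h1 := integral_sphereLaplacian_mul hu q
      rw [sphLap_of_mem_harmonic hq] at h1
      have h2 : ∀ x, sphereLaplacian u x * MvPolynomial.eval (x : E3) q =
          f x * MvPolynomial.eval (x : E3) q - 6 * (u x * MvPolynomial.eval (x : E3) q) :=
        fun x => by rw [← huf]; ring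
      have hq' := continuous_eval_sphere q
      simp only [h2, MvPolynomial.smul_eval, mul_left_comm _ (-((j : ℝ) * (j + 1)))] at h1
      rw [integral_sub (integrable_mul_of_continuous hf hq')
        ((integrable_mul_of_continuous hu.continuous hq').const_mul 6), integral_const_mul,
        integral_const_mul] at h1
      simp only [toSphere_apply]
      change ∫ x : S2, u x * MvPolynomial.eval (x : E3) q ∂sphMeas =
        _ * ∫ x : S2, f x * MvPolynomial.eval (x : E3) q ∂sphMeas
      rw [eq_inv_mul_iff_mul_eq₀ (gap j hj).1]
      linear_combination -h1
  have hmain := norm_le_of_inner_eq_mul_inner hE hD hDE (C := 1 / 4) (fun j => by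
    split_ifs with hj
    · norm_num
    · rw [abs_inv, one_div]
      exact inv_anti₀ (by norm_num) (gap j hj).2) hdiag
  refine ⟨A, hA, htr, ?_⟩
  have hw : ι uC - (E 2).starProjection (ι uC) = ι (uC - toSphere p) := by
    rw [hproj, map_sub]
  have h1 := pow_le_pow_left₀ (norm_nonneg _) hmain 2
  rw [hw, mul_pow, hnorm, hnorm] at h1
  norm_num at h1
  simp only [toSphere_apply, he] at h1
  exact h1

/-! ### Sixth moments of the sphere and the cubic form on quadratic harmonics -/

namespace Poly3

open MvPolynomial

/-- The integral over the unit sphere as a linear functional on polynomials. -/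
noncomputable def sphIntegral : Poly3 →ₗ[ℝ] ℝ where
  toFun p := ∫ x : S2, eval (x : E3) p ∂sphMeas
  map_add' p q := by
    simp only [map_add]
    exact integral_add (integrable_of_continuous (continuous_eval_sphere p))
      (integrable_of_continuous (continuous_eval_sphere q))
  map_smul' c p := by
    simp only [smul_eval]
    exact integral_const_mul _ _

theorem sphIntegral_apply (p : Poly3) :
    sphIntegral p = ∫ x : S2, eval (x : E3) p ∂sphMeas := rfl

/-- The mixed sixth moment `∫ x² y² z²` of the unit sphere. -/
noncomputable def mixedMoment : ℝ := sphIntegral (X 0 ^ 2 * X 1 ^ 2 * X 2 ^ 2)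

theorem mixedMoment_pos : 0 < mixedMoment := by
  let y : E3 := WithLp.toLp 2 fun _ => 1
  have hy : y ≠ 0 := fun h => by
    have := congrArg (fun z : E3 => z 0) h
    simp [y] at this
  have hc : Continuous fun x : S2 => eval (x : E3) (X 0 ^ 2 * X 1 ^ 2 * X 2 ^ 2 : Poly3) :=
    continuous_eval_sphere _
  refine hc.integral_pos_of_hasCompactSupport_nonneg_nonzero (HasCompactSupport.of_compactSpace _)
    (fun x => ?_) (x := ⟨‖y‖⁻¹ • y, normalize_mem_sphere hy⟩) ?_
  · simp only [map_mul, map_pow, eval_X, Pi.zero_apply]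
    positivity
  · have : ‖y‖ ≠ 0 := norm_ne_zero_iff.2 hy
    simp only [map_mul, map_pow, eval_X, PiLp.smul_apply, smul_eq_mul]
    simp [y]
    simpa [y] using hy

theorem sphIntegral_eq_of_rotDer_eq_sub (p q : Poly3) (h : ∃ i r, rotDer i r = p - q) :
    sphIntegral p = sphIntegral q := by
  obtain ⟨i, r, hr⟩ := h
  rw [← sub_eq_zero, ← map_sub, ← hr]
  exact integral_rotDer i r

theorem fin_three_ne (i : Fin 3) : i ≠ i + 1 ∧ i ≠ i + 2 ∧ i + 1 ≠ i + 2 := by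
  revert i; decide

theorem rotDer_X (i : Fin 3) : rotDer i (X i) = 0 ∧ rotDer i (X (i + 1)) = -X (i + 2) ∧
    rotDer i (X (i + 2)) = X (i + 1) := by
  obtain ⟨h1, h2, h3⟩ := fin_three_ne i
  simp only [rotDer_apply]
  rw [pderiv_X_of_ne h1, pderiv_X_of_ne h2, pderiv_X_of_ne h3, pderiv_X_of_ne h3.symm,
    pderiv_X_self, pderiv_X_self]
  refine ⟨?_, ?_, ?_⟩ <;> ring

theorem sphIntegral_mixed (i : Fin 3) :
    sphIntegral (X i ^ 2 * (X (i + 1) ^ 2 * X (i + 2) ^ 2)) = mixedMoment := by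
  rw [mixedMoment]
  congr 1
  fin_cases i <;> simp <;> ring

theorem sphIntegral_two_four (i : Fin 3) :
    sphIntegral (X i ^ 2 * X (i + 1) ^ 4) = 3 * mixedMoment := by
  rw [← sphIntegral_mixed i, ← smul_eq_mul (3 : ℝ), ← map_smul]
  refine sphIntegral_eq_of_rotDer_eq_sub _ _ ⟨i, X i ^ 2 * (X (i + 1) ^ 3 * X (i + 2)), ?_⟩
  obtain ⟨h1, h2, h3⟩ := rotDer_X i
  simp only [Derivation.leibniz, Derivation.leibniz_pow, h1, h2, h3, smul_eq_mul, nsmul_eq_mul,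
    smul_eq_C_mul, map_ofNat]
  push_cast
  ring

theorem sphIntegral_four_two (i : Fin 3) :
    sphIntegral (X i ^ 2 * X (i + 2) ^ 4) = 3 * mixedMoment := by
  rw [← sphIntegral_mixed i, ← smul_eq_mul (3 : ℝ), ← map_smul]
  refine sphIntegral_eq_of_rotDer_eq_sub _ _ ⟨i, -(X i ^ 2 * (X (i + 1) * X (i + 2) ^ 3)), ?_⟩
  obtain ⟨h1, h2, h3⟩ := rotDer_X i
  simp only [map_neg, Derivation.leibniz, Derivation.leibniz_pow, h1, h2, h3, smul_eq_mul,
    nsmul_eq_mul, smul_eq_C_mul, map_ofNat]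
  push_cast
  ring

theorem sphIntegral_six (i : Fin 3) : sphIntegral (X i ^ 6) = 15 * mixedMoment := by
  rw [show (15 : ℝ) * mixedMoment = 5 * (3 * mixedMoment) by ring, ← sphIntegral_four_two (i + 1),
    ← smul_eq_mul (5 : ℝ), ← map_smul]
  have e : i + 1 + 2 = i := by revert i; decide
  have e1 : i + 2 + 1 = i := by clear e; revert i; decide
  have e2 : i + 2 + 2 = i + 1 := by clear e e1; revert i; decide
  rw [e]
  refine sphIntegral_eq_of_rotDer_eq_sub _ _ ⟨i + 2, X i ^ 5 * X (i + 1), ?_⟩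
  obtain ⟨h1, h2, h3⟩ := rotDer_X (i + 2)
  rw [e1, e2] at h2 h3
  simp only [Derivation.leibniz, Derivation.leibniz_pow, h2, h3, smul_eq_mul, nsmul_eq_mul,
    smul_eq_C_mul, map_ofNat]
  push_cast
  ring

/-- For a traceless diagonal form `φ = ∑ aᵢ yᵢ²`, testing `φ²` against the harmonic form with
coefficients `aᵢ² - |a|²/3` gives a positive multiple of `|a|⁴`. In terms of the diagonal matrices
`A`, `B` of two such forms, the integral is `8 tr (A² B)` times the mixed moment, and
`tr A⁴ = (tr A²)² / 2` for traceless `3 × 3` matrices. -/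
theorem integral_diag_sq_mul {a : Fin 3 → ℝ} (ha : ∑ i, a i = 0) {t : ℝ} (ht : ∑ i, a i ^ 2 = t) :
    ∫ x : S2, (∑ i, a i * (x : E3) i ^ 2) ^ 2 * (∑ i, (a i ^ 2 - t / 3) * (x : E3) i ^ 2) ∂sphMeas =
      4 / 3 * mixedMoment * t ^ 2 := by
  have hint : ∀ b : Fin 3 → ℝ, ∫ x : S2, (∑ i, a i * (x : E3) i ^ 2) ^ 2 *
      (∑ i, b i * (x : E3) i ^ 2) ∂sphMeas = mixedMoment *
      (15 * (a 0 ^ 2 * b 0 + a 1 ^ 2 * b 1 + a 2 ^ 2 * b 2) +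
      3 * (a 0 ^ 2 * b 1 + 2 * a 0 * a 1 * b 0) + 3 * (a 0 ^ 2 * b 2 + 2 * a 0 * a 2 * b 0) +
      3 * (a 1 ^ 2 * b 0 + 2 * a 0 * a 1 * b 1) + 3 * (a 1 ^ 2 * b 2 + 2 * a 1 * a 2 * b 1) +
      3 * (a 2 ^ 2 * b 0 + 2 * a 0 * a 2 * b 2) + 3 * (a 2 ^ 2 * b 1 + 2 * a 1 * a 2 * b 2) +
      2 * (a 0 * a 1 * b 2 + a 0 * a 2 * b 1 + a 1 * a 2 * b 0)) := by
    intro b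
    have h : ∀ x : S2, (∑ i, a i * (x : E3) i ^ 2) ^ 2 * (∑ i, b i * (x : E3) i ^ 2) =
        eval (x : E3) ((a 0 ^ 2 * b 0) • X 0 ^ 6 + (a 1 ^ 2 * b 1) • X 1 ^ 6 +
        (a 2 ^ 2 * b 2) • X 2 ^ 6 +
        (a 0 ^ 2 * b 1 + 2 * a 0 * a 1 * b 0) • (X 1 ^ 2 * X (1 + 2) ^ 4) +
        (a 0 ^ 2 * b 2 + 2 * a 0 * a 2 * b 0) • (X 2 ^ 2 * X (2 + 1) ^ 4) +
        (a 1 ^ 2 * b 0 + 2 * a 0 * a 1 * b 1) • (X 0 ^ 2 * X (0 + 1) ^ 4) +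
        (a 1 ^ 2 * b 2 + 2 * a 1 * a 2 * b 1) • (X 2 ^ 2 * X (2 + 2) ^ 4) +
        (a 2 ^ 2 * b 0 + 2 * a 0 * a 2 * b 2) • (X 0 ^ 2 * X (0 + 2) ^ 4) +
        (a 2 ^ 2 * b 1 + 2 * a 1 * a 2 * b 2) • (X 1 ^ 2 * X (1 + 1) ^ 4) +
        (2 * (a 0 * a 1 * b 2 + a 0 * a 2 * b 1 + a 1 * a 2 * b 0)) •
          (X 0 ^ 2 * (X (0 + 1) ^ 2 * X (0 + 2) ^ 2))) := by
      intro x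
      simp only [map_add, smul_eval, map_mul, map_pow, eval_X, Fin.sum_univ_three, Fin.reduceAdd]
      ring
    simp only [h]
    rw [← sphIntegral_apply]
    simp only [map_add, map_smul, sphIntegral_six, sphIntegral_four_two, sphIntegral_two_four,
      sphIntegral_mixed, smul_eq_mul]
    ring
  rw [hint fun i => a i ^ 2 - t / 3]
  rw [Fin.sum_univ_three] at ha ht
  obtain rfl : a 0 ^ 2 + a 1 ^ 2 + a 2 ^ 2 = t := ht
  have h2 : a 2 = -a 0 - a 1 := by linarith
  rw [h2]
  ring

/-! ### Diagonalisation of quadratic forms -/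

/-- The matrix with eigenvalues `c k` along the vectors of an orthonormal basis `b`. -/
noncomputable def diagMatrix (b : OrthonormalBasis (Fin 3) ℝ E3) (c : Fin 3 → ℝ) :
    Matrix (Fin 3) (Fin 3) ℝ :=
  Matrix.of fun i j => ∑ k, c k * (b k i * b k j)

theorem trace_diagMatrix (b : OrthonormalBasis (Fin 3) ℝ E3) (c : Fin 3 → ℝ) :
    (diagMatrix b c).trace = ∑ k, c k := by
  simp only [Matrix.trace, Matrix.diag, diagMatrix, Matrix.of_apply]
  rw [Finset.sum_comm]
  refine Finset.sum_congr rfl fun k _ => ?_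
  have h := EuclideanSpace.real_norm_sq_eq (b k)
  rw [b.orthonormal.1 k, one_pow] at h
  rw [← Finset.mul_sum]
  simp only [← sq]
  rw [← h, mul_one]

theorem eval_quad_diagMatrix (b : OrthonormalBasis (Fin 3) ℝ E3) (c : Fin 3 → ℝ) (x : E3) :
    eval x (quad (diagMatrix b c)) = ∑ k, c k * b.repr x k ^ 2 := by
  have h : ∀ k, b.repr x k = ∑ i, b k i * x i := fun k => by
    rw [b.repr_apply_apply, PiLp.inner_apply]
    simp [mul_comm]
  simp only [eval_quad, h, diagMatrix, Matrix.of_apply, Fin.sum_univ_three]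
  ring

theorem exists_eq_diagMatrix {A : Matrix (Fin 3) (Fin 3) ℝ} (hA : A.IsSymm) :
    ∃ (b : OrthonormalBasis (Fin 3) ℝ E3) (c : Fin 3 → ℝ), A = diagMatrix b c := by
  have hH : A.IsHermitian := by
    rw [Matrix.IsHermitian, Matrix.conjTranspose_eq_transpose_of_trivial]
    exact hA
  refine ⟨hH.eigenvectorBasis, hH.eigenvalues, ?_⟩
  conv_lhs => rw [hH.spectral_theorem]
  ext i j
  simp [diagMatrix, Unitary.conjStarAlgAut_apply, Matrix.mul_apply, Matrix.diagonal_apply,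
    Matrix.star_apply]
  refine Finset.sum_congr rfl fun k _ => ?_
  ring

end Poly3

/-! ### Rigidity of small solutions -/

open Poly3 in
/-- If the test function `ψ` is a harmonic quadratic form, the equation leaves only the nonlinear
remainder. -/
theorem IsMeanFieldSolution.integral_remainder_mul_eq_zero {u : S2 → ℝ}
    (hu : IsMeanFieldSolution u) {B : Matrix (Fin 3) (Fin 3) ℝ} (hB : B.trace = 0) :
    ∫ x : S2, (Real.exp (u x) - 1 - u x) * MvPolynomial.eval (x : E3) (quad B) ∂sphMeas = 0 := by
  have hc := hu.1.continuous
  have hq := continuous_eval_sphere (quad B)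
  have h1 := integral_sphereLaplacian_mul hu.1 (quad B)
  have h2 : sphLap (quad B) = (-6 : ℝ) • quad B := by
    rw [sphLap_of_isHomogeneous (isHomogeneous_quad B), lap_quad, hB]
    norm_num
  rw [h2] at h1
  have h3 : ∀ x : S2, sphereLaplacian u x * MvPolynomial.eval (x : E3) (quad B) =
      -6 * (u x * MvPolynomial.eval (x : E3) (quad B)) +
      -6 * ((Real.exp (u x) - 1 - u x) * MvPolynomial.eval (x : E3) (quad B)) := fun x => by
    rw [hu.2 x]; ring
  have hN : Continuous fun x => Real.exp (u x) - 1 - u x := by fun_prop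
  simp only [h3, MvPolynomial.smul_eval, mul_left_comm _ (-6 : ℝ)] at h1
  rw [integral_add ((integrable_mul_of_continuous hc hq).const_mul _)
    ((integrable_mul_of_continuous hN hq).const_mul _), integral_const_mul,
    integral_const_mul] at h1
  linarith

/-- The third-order Taylor estimate for the exponential. -/
theorem abs_exp_sub_quadratic_le {s : ℝ} (hs : |s| ≤ 1) :
    |Real.exp s - 1 - s - s ^ 2 / 2| ≤ |s| ^ 3 := by
  have h := Real.exp_bound hs (n := 3) (by norm_num)
  simp only [Finset.sum_range_succ, Finset.sum_range_zero] at h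
  norm_num [Nat.factorial] at h
  rw [show Real.exp s - 1 - s - s ^ 2 / 2 = Real.exp s - (1 + s + s ^ 2 / 2) by ring]
  exact h.trans (by nlinarith [pow_nonneg (abs_nonneg s) 3])

theorem diagonal_form_bounds {a y : Fin 3 → ℝ} (hy : ∑ i, y i ^ 2 = 1) {t : ℝ}
    (ht : t = ∑ i, a i ^ 2) :
    (∑ i, a i * y i ^ 2) ^ 2 ≤ t ∧ |∑ i, (a i ^ 2 - t / 3) * y i ^ 2| ≤ t := by
  have hy1 : ∀ i, y i ^ 2 ≤ 1 := fun i =>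
    hy ▸ Finset.single_le_sum (f := fun i => y i ^ 2) (fun j _ => sq_nonneg _) (Finset.mem_univ i)
  have ht0 : 0 ≤ t := ht ▸ Finset.sum_nonneg fun i _ => sq_nonneg _
  constructor
  · have h1 : ∑ i, (y i ^ 2) ^ 2 ≤ 1 := by
      rw [← hy]
      exact Finset.sum_le_sum fun i _ => by nlinarith [hy1 i, sq_nonneg (y i)]
    calc _ ≤ (∑ i, a i ^ 2) * ∑ i, (y i ^ 2) ^ 2 := Finset.sum_mul_sq_le_sq_mul_sq _ _ _
      _ ≤ t := by rw [← ht]; nlinarith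
  · have h1 : ∑ i, (a i ^ 2 - t / 3) * y i ^ 2 = ∑ i, a i ^ 2 * y i ^ 2 - t / 3 := by
      simp only [sub_mul, Finset.sum_sub_distrib, ← Finset.mul_sum, hy, mul_one]
    have h2 : ∑ i, a i ^ 2 * y i ^ 2 ≤ t := by
      rw [ht]
      exact Finset.sum_le_sum fun i _ => mul_le_of_le_one_right (sq_nonneg _) (hy1 i)
    have h3 : 0 ≤ ∑ i, a i ^ 2 * y i ^ 2 := Finset.sum_nonneg fun i _ => by positivity
    rw [h1, abs_le]
    constructor <;> linarith

open Poly3 in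
/-- A solution with `|u| ≤ δ` vanishes once `δ` is small against explicit constants of the
sphere. -/
theorem IsMeanFieldSolution.eq_zero_of_abs_le {u : S2 → ℝ} (hu : IsMeanFieldSolution u) {δ : ℝ}
    (hδ : 0 < δ) (hδ3 : δ ≤ 1 / 3)
    (hδM : 20 * sphMeas.real Set.univ * δ ≤ mixedMoment) (hs : ∀ x, |u x| ≤ δ) (x : S2) :
    u x = 0 := by
  have hc : Continuous u := hu.1.continuous
  set N : S2 → ℝ := fun x => Real.exp (u x) - 1 - u x with hNdef
  have hN : Continuous N := by fun_prop
  obtain ⟨A, hA, htr, hclose⟩ := exists_harmonic_quad_close (f := fun x => -6 * N x) hu.1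
    (by fun_prop) fun x => by rw [hu.2]; simp only [hNdef]; ring
  obtain ⟨b, a, rfl⟩ := exists_eq_diagMatrix hA
  rw [trace_diagMatrix] at htr
  set t : ℝ := ∑ i, a i ^ 2 with ht
  have ht0 : 0 ≤ t := Finset.sum_nonneg fun i _ => sq_nonneg _
  set φ : S2 → ℝ := fun x => MvPolynomial.eval (x : E3) (quad (diagMatrix b a)) with hφ
  set ψ : S2 → ℝ := fun x =>
    MvPolynomial.eval (x : E3) (quad (diagMatrix b fun i => a i ^ 2 - t / 3)) with hψ
  have hφc : Continuous φ := continuous_eval_sphere _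
  have hψc : Continuous ψ := continuous_eval_sphere _
  have hNψ : ∫ x, N x * ψ x ∂sphMeas = 0 := hu.integral_remainder_mul_eq_zero (by
    rw [trace_diagMatrix, Finset.sum_sub_distrib, ← ht]
    simp only [Finset.sum_const, Finset.card_univ, Fintype.card_fin, nsmul_eq_mul]
    ring)
  have hcubic : ∫ x, φ x ^ 2 * ψ x ∂sphMeas = 4 / 3 * mixedMoment * t ^ 2 := by
    rw [← integral_diag_sq_mul htr ht.symm,
      ← integral_sphMap b.repr (fun x : S2 => (∑ i, a i * (x : E3) i ^ 2) ^ 2 *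
        (∑ i, (a i ^ 2 - t / 3) * (x : E3) i ^ 2)) (by fun_prop)]
    simp only [hφ, hψ, eval_quad_diagMatrix]
    rfl
  -- Both forms are controlled on the sphere by the size of the coefficients.
  have hbound : ∀ x, φ x ^ 2 ≤ t ∧ |ψ x| ≤ t := by
    intro x
    have hy : ∑ i, b.repr (x : E3) i ^ 2 = 1 := by
      rw [← EuclideanSpace.real_norm_sq_eq, b.repr.norm_map, norm_eq_of_mem_sphere, one_pow]
    simp only [hφ, hψ, eval_quad_diagMatrix]
    exact diagonal_form_bounds hy ht
  have hNu : ∀ x, |N x| ≤ u x ^ 2 := fun x =>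
    Real.abs_exp_sub_one_sub_id_le ((hs x).trans (by linarith))
  have hus : ∀ x, u x ^ 2 ≤ δ ^ 2 := fun x => by
    rw [← sq_abs]
    exact pow_le_pow_left₀ (abs_nonneg _) (hs x) 2
  set U : ℝ := ∫ x, u x ^ 2 ∂sphMeas with hU
  set Φ : ℝ := ∫ x, φ x ^ 2 ∂sphMeas with hΦ
  set W : ℝ := ∫ x, (u x - φ x) ^ 2 ∂sphMeas with hW
  have iu : Integrable (fun x => u x ^ 2) sphMeas := integrable_of_continuous (by fun_prop)
  have iφ : Integrable (fun x => φ x ^ 2) sphMeas := integrable_of_continuous (by fun_prop)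
  have iw : Integrable (fun x => (u x - φ x) ^ 2) sphMeas := integrable_of_continuous (by fun_prop)
  -- The remainder `N` is quadratic in `u`, so `u - φ` is small of higher order.
  have hWU : W ≤ 9 / 4 * δ ^ 2 * U := by
    have h1 : ∫ x, (-6 * N x) ^ 2 ∂sphMeas ≤ ∫ x, 36 * δ ^ 2 * u x ^ 2 ∂sphMeas := by
      refine integral_mono (integrable_of_continuous (by fun_prop)) (iu.const_mul _) fun x => ?_
      have h2 : N x ^ 2 ≤ (u x ^ 2) ^ 2 := by
        rw [← sq_abs]
        exact pow_le_pow_left₀ (abs_nonneg _) (hNu x) 2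
      have h3 := mul_le_mul_of_nonneg_right (hus x) (sq_nonneg (u x))
      dsimp only
      linarith
    rw [integral_const_mul] at h1
    have h4 : W ≤ 1 / 16 * ∫ x, (-6 * N x) ^ 2 ∂sphMeas := hclose
    linarith
  -- Hence the projection `φ` carries a fixed proportion of the mean square of `u`.
  have hUΦ : U ≤ 4 * Φ := by
    have h1 : U ≤ 2 * Φ + 2 * W := by
      rw [hU, hΦ, hW, ← integral_const_mul, ← integral_const_mul,
        ← integral_add (iφ.const_mul _) (iw.const_mul _)]
      refine integral_mono iu ((iφ.const_mul _).add (iw.const_mul _)) fun x => ?_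
      dsimp only [Pi.add_apply]
      linarith [sq_nonneg (u x - 2 * φ x)]
    have hU0 : 0 ≤ U := integral_nonneg fun x => sq_nonneg _
    have h2 : δ ^ 2 ≤ 1 / 9 := by nlinarith
    have h3 := mul_le_mul_of_nonneg_right h2 hU0
    linarith
  have hΦt : Φ ≤ t * sphMeas.real Set.univ := by
    have h1 : Φ ≤ ∫ _ : S2, t ∂sphMeas :=
      integral_mono iφ (integrable_const t) fun x => (hbound x).1
    rwa [integral_const, smul_eq_mul, mul_comm] at h1
  -- With `u = φ + w`, the identity `φ² - 2 N = -2 R - w (φ + u)` holds, where `R` is the cubic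
  -- remainder of the exponential; the product is split by the weighted arithmetic-geometric mean
  -- inequality so that both parts become of order `δ |φ|²`.
  have hpt : ∀ x, φ x ^ 2 * ψ x - 2 * (N x * ψ x) ≤
      t * (3 * δ * u x ^ 2 + (2 * δ)⁻¹ * (u x - φ x) ^ 2 + δ * φ x ^ 2) := by
    intro x
    have hR := abs_exp_sub_quadratic_le ((hs x).trans (by linarith) : |u x| ≤ 1)
    have hR' : |N x - u x ^ 2 / 2| ≤ δ * u x ^ 2 := by
      refine hR.trans ?_
      rw [pow_succ', sq_abs]
      exact mul_le_mul_of_nonneg_right (hs x) (sq_nonneg _)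
    have hprod : |(u x - φ x) * (φ x + u x)| ≤
        (2 * δ)⁻¹ * (u x - φ x) ^ 2 + δ * φ x ^ 2 + δ * u x ^ 2 := by
      have h1 : |(u x - φ x) * (φ x + u x)| ≤
          (2 * δ)⁻¹ * (u x - φ x) ^ 2 + δ / 2 * (φ x + u x) ^ 2 := by
        have h2 : (2 * δ)⁻¹ * (u x - φ x) ^ 2 + δ / 2 * (φ x + u x) ^ 2 =
            (2 * δ)⁻¹ * ((u x - φ x) ^ 2 + (δ * (φ x + u x)) ^ 2) := by
          field_simp
        rw [h2, le_inv_mul_iff₀ (by positivity)]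
        have h3 := two_mul_le_add_sq |u x - φ x| |δ * (φ x + u x)|
        rw [sq_abs, sq_abs, abs_mul δ, abs_of_pos hδ] at h3
        rw [abs_mul]
        linarith
      have h3 := mul_le_mul_of_nonneg_left
        (show (φ x + u x) ^ 2 ≤ 2 * (φ x ^ 2 + u x ^ 2) by nlinarith [sq_nonneg (φ x - u x)]) hδ.le
      linarith
    calc φ x ^ 2 * ψ x - 2 * (N x * ψ x)
        = (-2 * (N x - u x ^ 2 / 2) - (u x - φ x) * (φ x + u x)) * ψ x := by ring
      _ ≤ |-2 * (N x - u x ^ 2 / 2) - (u x - φ x) * (φ x + u x)| * |ψ x| := by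
          rw [← abs_mul]; exact le_abs_self _
      _ ≤ (2 * (δ * u x ^ 2) +
            ((2 * δ)⁻¹ * (u x - φ x) ^ 2 + δ * φ x ^ 2 + δ * u x ^ 2)) * t := by
          refine mul_le_mul ?_ (hbound x).2 (abs_nonneg _) (by positivity)
          refine (abs_sub _ _).trans (add_le_add ?_ hprod)
          rw [abs_mul, abs_neg, abs_two]
          exact mul_le_mul_of_nonneg_left hR' zero_le_two
      _ = _ := by ring
  have hint : 4 / 3 * mixedMoment * t ^ 2 ≤ t * (3 * δ * U + (2 * δ)⁻¹ * W + δ * Φ) := by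
    have iφψ : Integrable (fun x => φ x ^ 2 * ψ x) sphMeas :=
      integrable_of_continuous (by fun_prop)
    have iNψ : Integrable (fun x => 2 * (N x * ψ x)) sphMeas :=
      integrable_of_continuous (by fun_prop)
    have h1 := integral_mono (iφψ.sub iNψ)
      ((((iu.const_mul (3 * δ)).add (iw.const_mul (2 * δ)⁻¹)).add (iφ.const_mul δ)).const_mul t) hpt
    simp only [Pi.sub_apply, Pi.add_apply] at h1
    have h2 : ∫ x, (3 * δ * u x ^ 2 + (2 * δ)⁻¹ * (u x - φ x) ^ 2 + δ * φ x ^ 2) ∂sphMeas =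
        3 * δ * U + (2 * δ)⁻¹ * W + δ * Φ := by
      rw [hU, hW, hΦ, ← integral_const_mul, ← integral_const_mul, ← integral_const_mul,
        ← integral_add (iu.const_mul (3 * δ)) (iw.const_mul (2 * δ)⁻¹)]
      exact integral_add ((iu.const_mul (3 * δ)).add (iw.const_mul (2 * δ)⁻¹)) (iφ.const_mul δ)
    rw [integral_sub iφψ iNψ, hcubic, integral_const_mul, hNψ, integral_const_mul, h2] at h1
    linarith
  have ht_zero : t = 0 := by
    have h1 : (2 * δ)⁻¹ * W ≤ 9 / 8 * δ * U := by
      rw [inv_mul_le_iff₀ (by positivity)]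
      linarith
    have h2 : 3 * δ * U + (2 * δ)⁻¹ * W + δ * Φ ≤ 35 / 2 * δ * (t * sphMeas.real Set.univ) := by
      have h3 := mul_le_mul_of_nonneg_left hUΦ hδ.le
      have h4 := mul_le_mul_of_nonneg_left hΦt hδ.le
      linarith
    have h3 := hint.trans (mul_le_mul_of_nonneg_left h2 ht0)
    have h4 := mul_le_mul_of_nonneg_right hδM (sq_nonneg t)
    have h5 : mixedMoment * t ^ 2 ≤ 0 := by nlinarith
    have h6 := mixedMoment_pos
    have h7 : t ^ 2 ≤ 0 := by
      by_contra! h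
      exact absurd h5 (not_le.2 (mul_pos h6 h))
    exact pow_eq_zero_iff two_ne_zero |>.1 (le_antisymm h7 (sq_nonneg t))
  have hU_zero : U = 0 := by
    rw [ht_zero, zero_mul] at hΦt
    exact le_antisymm (by linarith) (integral_nonneg fun x => sq_nonneg _)
  by_contra hx
  have hpos : 0 < U := (hc.pow 2).integral_pos_of_hasCompactSupport_nonneg_nonzero
    (HasCompactSupport.of_compactSpace _) (fun x => sq_nonneg _) (x := x) (pow_ne_zero 2 hx)
  exact hpos.ne' hU_zero

theorem mainTheorem6 :
    ∃ δ₀ : ℝ, 0 < δ₀ ∧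
      ∀ u : S2 → ℝ, IsMeanFieldSolution u → (⨆ x : S2, |u x|) < δ₀ → ∀ x : S2, u x = 0 := by
  have hM := Poly3.mixedMoment_pos
  have hS : 0 ≤ sphMeas.real Set.univ := measureReal_nonneg
  have hδ : 0 < min (1 / 3) (Poly3.mixedMoment / (20 * (sphMeas.real Set.univ + 1))) := by
    positivity
  refine ⟨_, hδ, fun u hu hsup => hu.eq_zero_of_abs_le hδ (min_le_left _ _) ?_ fun x => ?_⟩
  · calc _ ≤ 20 * (sphMeas.real Set.univ + 1) *
          (Poly3.mixedMoment / (20 * (sphMeas.real Set.univ + 1))) :=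
          mul_le_mul (by linarith) (min_le_right _ _) hδ.le (by positivity)
      _ = _ := by field_simp
  · have hbdd : BddAbove (Set.range fun x => |u x|) :=
      (isCompact_range hu.1.continuous.abs).bddAbove
    exact (le_ciSup hbdd x).trans hsup.le
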